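/- Fix $d,n\ge 1$. For a unit vector $|\psi\rangle=\sum_{i,j}a_{ij}|i\rangle|j\rangle\in\mathbb C^d\otimes\mathbb C^d$ with coefficient matrix $A=(a_{ij})$, let $G(|\psi\rangle)=d\,[\det(A^\dagger A)]^{1/d}$ be its G-concurrence. For a density operator $\sigma$ on $\mathbb C^d\otimes\mathbb C^d$ let $G(\sigma)=\min\sum_i p_iG(|\psi_i\rangle)$, the minimum being over all finite pure-state decompositions $\sigma=\sum_i p_i|\psi_i\rangle\langle\psi_i|$ ($p_i\ge0$, $\sum_i p_i=1$, $|\psi_i\rangle$ unit vectors). For a unit vector $|\psi\rangle_{ABS}\in\mathbb C^d\otimes\mathbb C^d\otimes\mathbb C^n$ let $G_a(|\psi\rangle_{ABS})=\max\sum_i p_iG(|\phi_i\rangle)$ over all pure-state decompositions $\mathrm{Tr}_S|\psi\rangle\langle\psi|=\sum_i p_i|\phi_i\rangle\langle\phi_i|$, and for a density operator $\rho_{ABS}$ on $\mathbb C^d\otimes\mathbb C^d\otimes\mathbb C^n$ let the G-concurrence of assistance be $G_a(\rho_{ABS})=\min\sum_j q_jG_a(|\psi_j\rangle_{ABS})$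 over all pure-state decompositions $\rho_{ABS}=\sum_j q_j|\psi_j\rangle\langle\psi_j|$. Let the assisted G-concurrence $A_G(\rho_{ABS})$ be the supremum of $\sum_k p_kG(\sigma_k^{AB})$ over all finite ensembles $\{p_k,\sigma_k^{AB}\}$ of states on $\mathbb C^d\otimes\mathbb C^d$ that Alice and Bob can share after a tripartite LOCC protocol applied to $\rho_{ABS}$. Here an LOCC protocol consists of finitely many rounds; in each round one of the three parties (Alice, Bob or Sapna) applies a quantum instrument with finitely many outcomes to its own system (whose dimension may change) and broadcasts the outcome, on which everything that follows may depend; at the end Alice and Bob each hold a $d$-dimensional system, Sapna's system is discarded, and $k$ is a function of the broadcast outcomes. Then for every density operator $\rho_{ABS}$ on $\mathbb C^d\otimes\mathbb C^d\otimes\mathbb C^n$ the set of these averages is bounded above, and $$A_G(\rho_{ABS})\le G_a(\rho_{ABS}).$$ -/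

import Mathlib

open scoped Matrix Kronecker ComplexOrder

namespace GConcurrence

noncomputable section

/-- Operators on a finite-dimensional Hilbert space with orthonormal basis `ι`. -/
abbrev Op (ι : Type) := Matrix ι ι ℂ

/-- The basis of `ℂ^a ⊗ ℂ^b ⊗ ℂ^s`, the space of Alice, Bob and Sapna. -/
abbrev ABS (a b s : ℕ) := Fin a × Fin b × Fin s

/-- The basis of `ℂ^d ⊗ ℂ^d`, the space of Alice and Bob. -/
abbrev AB (d : ℕ) := Fin d × Fin d

/-- Density operators (mixed states): positive semidefinite with trace one. -/
def IsDensity {ι : Type} [Fintype ι] (ρ : Op ι) : Prop :=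
  ρ.PosSemidef ∧ ρ.trace = 1

/-- Pure states: unit vectors, `⟨ψ|ψ⟩ = 1`. -/
def IsPure {ι : Type} [Fintype ι] (ψ : ι → ℂ) : Prop :=
  star ψ ⬝ᵥ ψ = 1

/-- The rank-one operator `|ψ⟩⟨ψ|`. -/
def proj {ι : Type} (ψ : ι → ℂ) : Op ι :=
  Matrix.vecMulVec ψ (star ψ)

/-- `{p i, φ i}` is a (finite) pure-state decomposition of `ρ`. -/
structure IsDecomposition {ι : Type} [Fintype ι] (ρ : Op ι) {m : ℕ}
    (p : Fin m → ℝ) (φ : Fin m → ι → ℂ) : Prop where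
  nonneg : ∀ i, 0 ≤ p i
  sum_eq_one : ∑ i, p i = 1
  pure : ∀ i, IsPure (φ i)
  eq_sum : ρ = ∑ i, (p i : ℂ) • proj (φ i)

/-- The averages `∑ i, p i * f (φ i)` over all pure-state decompositions of `ρ`. -/
def decompositionAverages {ι : Type} [Fintype ι] (f : (ι → ℂ) → ℝ) (ρ : Op ι) : Set ℝ :=
  {x | ∃ (m : ℕ) (p : Fin m → ℝ) (φ : Fin m → ι → ℂ),
    IsDecomposition ρ p φ ∧ x = ∑ i, p i * f (φ i)}

/-- The convex roof of `f` at `ρ`. -/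
def convexRoof {ι : Type} [Fintype ι] (f : (ι → ℂ) → ℝ) (ρ : Op ι) : ℝ :=
  sInf (decompositionAverages f ρ)

/-- Partial trace over Sapna's system. -/
def traceS {a b s : ℕ} (ρ : Op (ABS a b s)) : Op (Fin a × Fin b) :=
  Matrix.of fun x y => ∑ k : Fin s, ρ (x.1, x.2, k) (y.1, y.2, k)

/-- The matrix `A = (a i j)` of coefficients of `ψ = ∑ i j, a i j |i⟩|j⟩`. -/
def coeffMatrix {d : ℕ} (ψ : AB d → ℂ) : Matrix (Fin d) (Fin d) ℂ :=
  Matrix.of fun i j => ψ (i, j)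

/-- The G-concurrence of a pure bipartite state, `d * det (A† A) ^ (1/d)`. -/
def gPure {d : ℕ} (ψ : AB d → ℂ) : ℝ :=
  (d : ℝ) * ((coeffMatrix ψ)ᴴ * coeffMatrix ψ).det.re ^ ((1 : ℝ) / (d : ℝ))

/-- The G-concurrence of a mixed bipartite state. -/
def gConcurrence {d : ℕ} (ρ : Op (AB d)) : ℝ :=
  convexRoof gPure ρ

/-- The G-concurrence of assistance of a pure tripartite state. -/
def assistancePure {d n : ℕ} (ψ : ABS d d n → ℂ) : ℝ :=
  sSup (decompositionAverages gPure (traceS (proj ψ)))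

/-- The G-concurrence of assistance `G_a` of a mixed tripartite state. -/
def assistance {d n : ℕ} (ρ : Op (ABS d d n)) : ℝ :=
  convexRoof assistancePure ρ

/-- A local quantum instrument on an `a`-dimensional system, in Kraus form. Outcome `k` applies the
completely positive map with Kraus operators `kraus k j`; the dimension of the system that is left
may depend on the outcome, so that ancillas may be adjoined and subsystems discarded. -/
structure Instrument (a : ℕ) where
  outcomes : ℕ
  outDim : Fin outcomes → ℕ
  numKraus : Fin outcomes → ℕ
  kraus : (k : Fin outcomes) → Fin (numKraus k) → Matrix (Fin (outDim k)) (Fin a) ℂ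
  complete : ∑ k, ∑ j, (kraus k j)ᴴ * kraus k j = 1

/-- Alice applies the operation of outcome `k`: `ρ ↦ ∑ j, (M j ⊗ 1 ⊗ 1) ρ (M j ⊗ 1 ⊗ 1)†`. -/
def Instrument.onA {a b s : ℕ} (I : Instrument a) (k : Fin I.outcomes) (ρ : Op (ABS a b s)) :
    Op (ABS (I.outDim k) b s) :=
  ∑ j, (I.kraus k j ⊗ₖ (1 : Op (Fin b × Fin s))) * ρ *
    (I.kraus k j ⊗ₖ (1 : Op (Fin b × Fin s)))ᴴ

/-- Bob applies the operation of outcome `k`: `ρ ↦ ∑ j, (1 ⊗ M j ⊗ 1) ρ (1 ⊗ M j ⊗ 1)†`. -/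
def Instrument.onB {a b s : ℕ} (I : Instrument b) (k : Fin I.outcomes) (ρ : Op (ABS a b s)) :
    Op (ABS a (I.outDim k) s) :=
  ∑ j, ((1 : Op (Fin a)) ⊗ₖ (I.kraus k j ⊗ₖ (1 : Op (Fin s)))) * ρ *
    ((1 : Op (Fin a)) ⊗ₖ (I.kraus k j ⊗ₖ (1 : Op (Fin s))))ᴴ

/-- Sapna applies the operation of outcome `k`: `ρ ↦ ∑ j, (1 ⊗ 1 ⊗ M j) ρ (1 ⊗ 1 ⊗ M j)†`. -/
def Instrument.onS {a b s : ℕ} (I : Instrument s) (k : Fin I.outcomes) (ρ : Op (ABS a b s)) :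
    Op (ABS a b (I.outDim k)) :=
  ∑ j, ((1 : Op (Fin a)) ⊗ₖ ((1 : Op (Fin b)) ⊗ₖ I.kraus k j)) * ρ *
    ((1 : Op (Fin a)) ⊗ₖ ((1 : Op (Fin b)) ⊗ₖ I.kraus k j))ᴴ

/-- Tripartite LOCC protocols that start on `ℂ^a ⊗ ℂ^b ⊗ ℂ^s` and leave Alice and Bob with
`ℂ^d ⊗ ℂ^d`. In every round one party applies a local instrument and broadcasts the outcome, on
which the whole continuation may depend. At the end a classical label in `Fin m`, computed from the
broadcast outcomes, is kept (distinct histories may receive the same label), and Sapna's system is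
discarded. -/
inductive LOCC (d m : ℕ) : ℕ → ℕ → ℕ → Type
  | done {s : ℕ} (label : Fin m) : LOCC d m d d s
  | alice {a b s : ℕ} (I : Instrument a)
      (next : (k : Fin I.outcomes) → LOCC d m (I.outDim k) b s) : LOCC d m a b s
  | bob {a b s : ℕ} (I : Instrument b)
      (next : (k : Fin I.outcomes) → LOCC d m a (I.outDim k) s) : LOCC d m a b s
  | sapna {a b s : ℕ} (I : Instrument s)
      (next : (k : Fin I.outcomes) → LOCC d m a b (I.outDim k)) : LOCC d m a b s

/-- The unnormalized state of Alice and Bob on the event that the final label is `l`. -/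
def LOCC.output {d m : ℕ} : {a b s : ℕ} → LOCC d m a b s → Op (ABS a b s) → Fin m → Op (AB d)
  | _, _, _, .done label, ρ, l => if l = label then traceS ρ else 0
  | _, _, _, .alice I next, ρ, l => ∑ k, (next k).output (I.onA k ρ) l
  | _, _, _, .bob I next, ρ, l => ∑ k, (next k).output (I.onB k ρ) l
  | _, _, _, .sapna I next, ρ, l => ∑ k, (next k).output (I.onS k ρ) l

/-- The probability of the final label `l`. -/
def LOCC.prob {d m a b s : ℕ} (P : LOCC d m a b s) (ρ : Op (ABS a b s)) (l : Fin m) : ℝ :=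
  (P.output ρ l).trace.re

/-- The (normalized) state shared by Alice and Bob given the final label `l`. -/
def LOCC.state {d m a b s : ℕ} (P : LOCC d m a b s) (ρ : Op (ABS a b s)) (l : Fin m) : Op (AB d) :=
  ((P.prob ρ l)⁻¹ : ℂ) • P.output ρ l

/-- The averages `∑ l, p l * G (σ l)` over all ensembles `{p l, σ l}` that Alice and Bob can share
after a tripartite LOCC protocol on `ρ`. -/
def assistedAverages {d n : ℕ} (ρ : Op (ABS d d n)) : Set ℝ :=
  {x | ∃ (m : ℕ) (P : LOCC d m d d n), x = ∑ l, P.prob ρ l * gConcurrence (P.state ρ l)}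

/-- The assisted G-concurrence `A_G`. -/
def assistedG {d n : ℕ} (ρ : Op (ABS d d n)) : ℝ :=
  sSup (assistedAverages ρ)

end

end GConcurrence

namespace GConcurrence

open Matrix

/-! G-concurrence is multiplicative under local operators: a slice with coefficient matrix `A`
becomes `X A Yᵀ`, so its value is multiplied by `detRoot X * detRoot Y` (`gPure_sliceS_applyAB`). By
Minkowski's inequality (`sum_detRoot_le`) the factors of all Kraus branches of an instrument of
Alice or Bob sum to at most the factor before it. Sapna's instruments only refine the state of Alice
and Bob into a decomposition.

Induction on the protocol (`LOCC.exists_values_output`) keeps each branch in the form `(X ⊗ Y ⊗ 1)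
Φ`, where `Φ` absorbs Sapna's operators. Her later choices may depend on Alice's and Bob's outcomes,
so different branches yield different decompositions of the same state; the best one bounds them
all. This gives the bound for a pure initial state. Linearity of the output and convexity of the
roof extend it to every decomposition of `ρ`, and the infimum over these is `G_a`. -/

/-! ### The Minkowski determinant inequality -/

/-- `det (Xᴴ X) ^ (1/d)` for a matrix `X` with `d` columns. -/
noncomputable def detRoot {d a : ℕ} (X : Matrix (Fin a) (Fin d) ℂ) : ℝ :=
  (Xᴴ * X).det.re ^ ((1 : ℝ) / d)

lemma det_conjTranspose_mul_self_nonneg {d a : ℕ} (X : Matrix (Fin a) (Fin d) ℂ) :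
    0 ≤ (Xᴴ * X).det.re :=
  (Complex.nonneg_iff.1 (posSemidef_conjTranspose_mul_self X).det_nonneg).1

lemma detRoot_nonneg {d a : ℕ} (X : Matrix (Fin a) (Fin d) ℂ) : 0 ≤ detRoot X :=
  Real.rpow_nonneg (det_conjTranspose_mul_self_nonneg X) _

lemma detRoot_square {d : ℕ} (X : Matrix (Fin d) (Fin d) ℂ) :
    detRoot X = (‖X.det‖ ^ 2) ^ ((1 : ℝ) / d) := by
  rw [detRoot, det_mul, det_conjTranspose, Complex.star_def, ← Complex.normSq_eq_conj_mul_self,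
    Complex.ofReal_re, Complex.normSq_eq_norm_sq]

/-- Only the right factor has to be square: the determinant of `Cᴴ (Xᴴ X) C` splits although `X`
itself may be rectangular. -/
lemma detRoot_mul {d a : ℕ} (X : Matrix (Fin a) (Fin d) ℂ) (C : Matrix (Fin d) (Fin d) ℂ) :
    detRoot (X * C) = detRoot X * detRoot C := by
  have h : ((X * C)ᴴ * (X * C)).det.re = (Xᴴ * X).det.re * ‖C.det‖ ^ 2 := by
    have : (X * C)ᴴ * (X * C) = Cᴴ * (Xᴴ * X) * C := by
      simp only [conjTranspose_mul, Matrix.mul_assoc]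
    rw [this, det_mul, det_mul, det_conjTranspose, mul_comm (star C.det), mul_assoc,
      Complex.star_def, ← Complex.normSq_eq_conj_mul_self, Complex.re_mul_ofReal,
      Complex.normSq_eq_norm_sq]
  rw [detRoot_square C, detRoot, detRoot, h,
    Real.mul_rpow (det_conjTranspose_mul_self_nonneg X) (by positivity)]

lemma detRoot_transpose {d : ℕ} (X : Matrix (Fin d) (Fin d) ℂ) : detRoot Xᵀ = detRoot X := by
  rw [detRoot_square, detRoot_square, det_transpose]

lemma detRoot_one {d : ℕ} : detRoot (1 : Matrix (Fin d) (Fin d) ℂ) = 1 := by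
  simp [detRoot_square]

/-- The inequality of arithmetic and geometric means for the singular values of `X`. -/
lemma mul_detRoot_le_trace {d a : ℕ} (hd : 0 < d) (X : Matrix (Fin a) (Fin d) ℂ) :
    d * detRoot X ≤ (Xᴴ * X).trace.re := by
  have hd' : (0 : ℝ) < d := by exact_mod_cast hd
  have hP := posSemidef_conjTranspose_mul_self X
  have h := Real.geom_mean_le_arith_mean_weighted Finset.univ (fun _ : Fin d => (1 : ℝ) / d)
    hP.isHermitian.eigenvalues (fun _ _ => by positivity)
    (by simp [hd'.ne']) (fun i _ => hP.eigenvalues_nonneg i)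
  rw [Real.finsetProd_rpow _ _ (fun i _ => hP.eigenvalues_nonneg i), ← Finset.mul_sum] at h
  rw [detRoot, hP.isHermitian.det_eq_prod_eigenvalues, hP.isHermitian.trace_eq_sum_eigenvalues]
  simp only [Complex.coe_algebraMap, ← Complex.ofReal_prod, ← Complex.ofReal_sum,
    Complex.ofReal_re]
  calc _ ≤ (d : ℝ) * (1 / d * ∑ i, hP.isHermitian.eigenvalues i) := by gcongr
    _ = _ := by field_simp

/-- Minkowski's determinant inequality. -/
lemma sum_detRoot_le {d a : ℕ} (hd : 0 < d) {κ : Type*} [Fintype κ] {c : κ → ℕ}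
    (M : (k : κ) → Matrix (Fin (c k)) (Fin d) ℂ) (X : Matrix (Fin a) (Fin d) ℂ)
    (h : ∑ k, (M k)ᴴ * M k = Xᴴ * X) : ∑ k, detRoot (M k) ≤ detRoot X := by
  have hd' : (0 : ℝ) < d := by exact_mod_cast hd
  have hP := posSemidef_conjTranspose_mul_self X
  by_cases h0 : (Xᴴ * X).det = 0
  -- Singular case: a kernel vector `v` of `Xᴴ X` satisfies `∑ ‖M k v‖² = 0`, so every `M k` kills
  -- it and every term vanishes.
  · obtain ⟨v, hv, hXv⟩ := exists_mulVec_eq_zero_iff.2 h0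
    have hz : ∑ k, star (M k *ᵥ v) ⬝ᵥ (M k *ᵥ v) = 0 := by
      have : star v ⬝ᵥ ((∑ k, (M k)ᴴ * M k) *ᵥ v) = 0 := by rw [h, hXv, dotProduct_zero]
      rw [sum_mulVec, dotProduct_sum] at this
      rw [← this]
      refine Finset.sum_congr rfl fun k _ => ?_
      rw [star_mulVec, ← mulVec_mulVec, dotProduct_mulVec (star v)]
    rw [Finset.sum_eq_zero_iff_of_nonneg (fun k _ => dotProduct_star_self_nonneg _)] at hz
    refine (Finset.sum_eq_zero fun k _ => ?_).trans_le (detRoot_nonneg X)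
    have hk : ((M k)ᴴ * M k).det = 0 := by
      refine exists_mulVec_eq_zero_iff.1 ⟨v, hv, ?_⟩
      rw [conjTranspose_mul_self_mulVec_eq_zero]
      exact dotProduct_star_self_eq_zero.1 (hz k (Finset.mem_univ k))
    rw [detRoot, hk, Complex.zero_re, Real.zero_rpow (by positivity)]
  -- Regular case: passing to `M k * C⁻¹` normalizes the Gram sum to `1`; the arithmetic-geometric
  -- mean inequality then bounds `d` times the sum of roots by `trace 1 = d`.
  · obtain ⟨C, hC⟩ : ∃ C : Matrix (Fin d) (Fin d) ℂ, Xᴴ * X = Cᴴ * C := by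
      open scoped MatrixOrder in
      exact CStarAlgebra.nonneg_iff_eq_star_mul_self.1 hP.nonneg
    have hdet : C.det ≠ 0 := by
      rintro h1
      exact h0 (by rw [hC, det_mul, h1, mul_zero])
    have hu : IsUnit C.det := isUnit_iff_ne_zero.2 hdet
    have hXC : detRoot X = detRoot C := by rw [detRoot, detRoot, hC]
    have hM : ∀ k, detRoot (M k) = detRoot (M k * C⁻¹) * detRoot C := fun k => by
      rw [← detRoot_mul, Matrix.mul_assoc, nonsing_inv_mul _ hu, Matrix.mul_one]
    have hone : ∑ k, (M k * C⁻¹)ᴴ * (M k * C⁻¹) = 1 := by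
      have : ∀ k, (M k * C⁻¹)ᴴ * (M k * C⁻¹) = (C⁻¹)ᴴ * ((M k)ᴴ * M k) * C⁻¹ := fun k => by
        simp only [conjTranspose_mul, Matrix.mul_assoc]
      simp only [this]
      rw [← Finset.sum_mul, ← Finset.mul_sum, h, hC, ← Matrix.mul_assoc, ← conjTranspose_mul,
        mul_nonsing_inv _ hu, conjTranspose_one, Matrix.one_mul, mul_nonsing_inv _ hu]
    have hsum : ∑ k, detRoot (M k * C⁻¹) ≤ 1 := by
      have h1 : (d : ℝ) * ∑ k, detRoot (M k * C⁻¹) ≤ d := by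
        rw [Finset.mul_sum]
        refine (Finset.sum_le_sum fun k _ => mul_detRoot_le_trace hd (M k * C⁻¹)).trans_eq ?_
        rw [← Complex.re_sum, ← trace_sum, hone]
        simp
      exact le_of_mul_le_mul_left (by simpa using h1) hd'
    rw [hXC]
    simp only [hM]
    rw [← Finset.sum_mul]
    exact mul_le_of_le_one_left (detRoot_nonneg C) hsum

lemma gPure_eq {d : ℕ} (ψ : AB d → ℂ) : gPure ψ = d * detRoot (coeffMatrix ψ) := rfl

lemma gPure_nonneg {d : ℕ} (ψ : AB d → ℂ) : 0 ≤ gPure ψ :=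
  mul_nonneg (Nat.cast_nonneg d) (detRoot_nonneg _)

lemma gPure_smul {d : ℕ} (r : ℝ) (ψ : AB d → ℂ) : gPure ((r : ℂ) • ψ) = r ^ 2 * gPure ψ := by
  rcases Nat.eq_zero_or_pos d with rfl | hd
  · simp [gPure]
  have hd' : (d : ℝ) ≠ 0 := by exact_mod_cast hd.ne'
  have h : coeffMatrix ((r : ℂ) • ψ) = coeffMatrix ψ * ((r : ℂ) • (1 : Matrix _ _ ℂ)) := by
    ext i j; simp [coeffMatrix]
  have h1 : detRoot ((r : ℂ) • (1 : Matrix (Fin d) (Fin d) ℂ)) = r ^ 2 := by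
    rw [detRoot_square, det_smul, det_one, mul_one, Fintype.card_fin, norm_pow, ← pow_mul,
      mul_comm d, pow_mul, ← Real.rpow_natCast _ d, ← Real.rpow_mul (by positivity),
      mul_one_div_cancel hd', Real.rpow_one]
    simp
  rw [gPure_eq, gPure_eq, h, detRoot_mul, h1]
  ring

lemma gPure_le {d : ℕ} (hd : 0 < d) (ψ : AB d → ℂ) : gPure ψ ≤ (proj ψ).trace.re := by
  refine (mul_detRoot_le_trace hd _).trans_eq (congrArg Complex.re ?_)
  simp only [trace, diag, mul_apply, proj, vecMulVec_apply, conjTranspose_apply, coeffMatrix,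
    of_apply, Fintype.sum_prod_type, Pi.star_apply]
  rw [Finset.sum_comm]
  simp only [mul_comm]

/-! ### Decompositions into unnormalized pure states -/

/-- The sums `∑ i, G (v i)` over all finite families of vectors with `∑ i, |v i⟩⟨v i| = σ`. -/
def unnormalizedValues {d : ℕ} (σ : Op (AB d)) : Set ℝ :=
  {x | ∃ (κ : Type) (_ : Fintype κ) (v : κ → AB d → ℂ),
    ∑ i, proj (v i) = σ ∧ x = ∑ i, gPure (v i)}

lemma proj_smul {ι : Type} (r : ℝ) (ψ : ι → ℂ) :
    proj ((r : ℂ) • ψ) = ((r ^ 2 : ℝ) : ℂ) • proj ψ := by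
  ext x y
  simp [proj, vecMulVec_apply]
  ring

lemma trace_proj {ι : Type} [Fintype ι] (ψ : ι → ℂ) : (proj ψ).trace = star ψ ⬝ᵥ ψ := by
  rw [proj, trace_vecMulVec, dotProduct_comm]

lemma mul_proj_mul {ι κ : Type} [Fintype ι] (M : Matrix κ ι ℂ) (ψ : ι → ℂ) :
    M * proj ψ * Mᴴ = proj (M *ᵥ ψ) := by
  rw [proj, mul_vecMulVec, vecMulVec_mul, proj, star_mulVec]

/-- Every positive semidefinite operator is a sum of rank-one operators. -/
lemma exists_sum_proj {ι : Type} [Fintype ι] {ρ : Op ι} (hρ : ρ.PosSemidef) :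
    ∃ v : ι → ι → ℂ, ∑ i, proj (v i) = ρ := by
  classical
  obtain ⟨C, hC⟩ : ∃ C : Op ι, ρ = Cᴴ * C := by
    open scoped MatrixOrder in
    exact CStarAlgebra.nonneg_iff_eq_star_mul_self.1 hρ.nonneg
  -- `Cᴴ C` is the sum of the projectors on the conjugated rows of `C`.
  refine ⟨fun k x => star (C k x), ?_⟩
  ext x y
  simp [hC, Matrix.sum_apply, proj, vecMulVec_apply, mul_apply]

/-- A decomposition into unnormalized vectors of an operator of trace one can be normalized. -/
lemma exists_isDecomposition {ι κ : Type} [Fintype ι] [Fintype κ] {ρ : Op ι} (hρ : ρ.trace = 1)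
    (v : κ → ι → ℂ) (hv : ∑ k, proj (v k) = ρ) :
    ∃ (m : ℕ) (p : Fin m → ℝ) (φ : Fin m → ι → ℂ) (e : Fin m ≃ κ),
      IsDecomposition ρ p φ ∧ ∀ i, v (e i) = (√(p i) : ℂ) • φ i := by
  classical
  let N : κ → ℝ := fun k => (star (v k) ⬝ᵥ v k).re
  have hN : ∀ k, star (v k) ⬝ᵥ v k = N k := fun k =>
    (Complex.ext rfl (Complex.nonneg_iff.1 (dotProduct_star_self_nonneg (v k))).2.symm)
  have hN0 : ∀ k, 0 ≤ N k := fun k =>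
    (Complex.nonneg_iff.1 (dotProduct_star_self_nonneg (v k))).1
  -- A basis vector serves as the unit vector for terms of weight zero; trace one ensures that there
  -- is one.
  obtain ⟨x₀⟩ : Nonempty ι := by
    by_contra hne
    rw [not_nonempty_iff] at hne
    simp [trace] at hρ
  have hφ : ∀ k, ∃ φ : ι → ℂ, IsPure φ ∧ v k = (√(N k) : ℂ) • φ := fun k => by
    by_cases h0 : N k = 0
    · refine ⟨Pi.single x₀ 1, by simp [IsPure], ?_⟩
      have : v k = 0 := dotProduct_star_self_eq_zero.1 (by rw [hN k, h0, Complex.ofReal_zero])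
      simp [this, h0]
    · have hpos : 0 < N k := lt_of_le_of_ne (hN0 k) (Ne.symm h0)
      have hs : (√(N k) : ℂ) ≠ 0 := by exact_mod_cast (Real.sqrt_pos.2 hpos).ne'
      refine ⟨(√(N k) : ℂ)⁻¹ • v k, ?_, by rw [smul_smul, mul_inv_cancel₀ hs, one_smul]⟩
      have h2 : (√(N k) : ℂ) * √(N k) = N k := by exact_mod_cast Real.mul_self_sqrt (hN0 k)
      rw [IsPure, star_smul, smul_dotProduct, dotProduct_smul, hN k, ← h2]
      simp [hs]
  choose φ hpure hvφ using hφ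
  have hproj : ∀ k, proj (v k) = (N k : ℂ) • proj (φ k) := fun k => by
    rw [hvφ k, proj_smul, Real.sq_sqrt (hN0 k)]
  let e := (Fintype.equivFin κ).symm
  refine ⟨Fintype.card κ, fun i => N (e i), fun i => φ (e i), e,
    ⟨fun i => hN0 _, ?_, fun i => hpure _, ?_⟩, fun i => hvφ _⟩
  · rw [Equiv.sum_comp e N]
    have : ((∑ k, N k : ℝ) : ℂ) = 1 := by
      rw [← hρ, ← hv, trace_sum, Complex.ofReal_sum]
      exact Finset.sum_congr rfl fun k _ => by rw [trace_proj, hN]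
    exact_mod_cast this
  · rw [Equiv.sum_comp e (fun k => (N k : ℂ) • proj (φ k)), ← hv]
    exact Finset.sum_congr rfl fun k _ => hproj k

section

variable {d : ℕ}

lemma unnormalizedValues_nonneg {σ : Op (AB d)} {x : ℝ} (hx : x ∈ unnormalizedValues σ) :
    0 ≤ x := by
  obtain ⟨κ, _, v, -, rfl⟩ := hx
  exact Finset.sum_nonneg fun i _ => gPure_nonneg _

/-- Decompositions of the summands concatenate. This is the convexity of the roof, free of
normalization. -/
lemma sum_mem_unnormalizedValues {κ : Type} [Fintype κ] {σ : κ → Op (AB d)} {x : κ → ℝ}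
    (h : ∀ k, x k ∈ unnormalizedValues (σ k)) :
    ∑ k, x k ∈ unnormalizedValues (∑ k, σ k) := by
  choose τ inst v hv hx using h
  refine ⟨Σ k, τ k, inferInstance, fun i => v i.1 i.2, ?_, ?_⟩
  · rw [Fintype.sum_sigma]
    exact Finset.sum_congr rfl fun k _ => hv k
  · rw [Fintype.sum_sigma]
    exact Finset.sum_congr rfl fun k _ => hx k

lemma zero_mem_unnormalizedValues : (0 : ℝ) ∈ unnormalizedValues (0 : Op (AB d)) :=
  ⟨Empty, inferInstance, fun i => i.elim, by simp, by simp⟩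

lemma smul_mem_unnormalizedValues {σ : Op (AB d)} {x : ℝ} (hx : x ∈ unnormalizedValues σ)
    {c : ℝ} (hc : 0 ≤ c) : c * x ∈ unnormalizedValues ((c : ℂ) • σ) := by
  obtain ⟨κ, _, v, hv, rfl⟩ := hx
  refine ⟨κ, inferInstance, fun i => (√c : ℂ) • v i, ?_, ?_⟩
  · simp only [proj_smul, Real.sq_sqrt hc, ← Finset.smul_sum, hv]
  · simp only [gPure_smul, Real.sq_sqrt hc, Finset.mul_sum]

lemma mem_decompositionAverages_gPure {σ : Op (AB d)} (hσ : σ.trace = 1) {x : ℝ}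
    (hx : x ∈ unnormalizedValues σ) : x ∈ decompositionAverages gPure σ := by
  obtain ⟨κ, _, v, hv, rfl⟩ := hx
  obtain ⟨m, p, φ, e, h, he⟩ := exists_isDecomposition hσ v hv
  refine ⟨m, p, φ, h, ?_⟩
  rw [← Equiv.sum_comp e]
  exact Finset.sum_congr rfl fun i _ => by rw [he, gPure_smul, Real.sq_sqrt (h.nonneg i)]

lemma trace_nonneg_of_mem_unnormalizedValues {σ : Op (AB d)} {x : ℝ}
    (hx : x ∈ unnormalizedValues σ) : 0 ≤ σ.trace := by
  obtain ⟨κ, _, v, rfl, -⟩ := hx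
  rw [trace_sum]
  exact Finset.sum_nonneg fun i _ => by
    rw [trace_proj]; exact dotProduct_star_self_nonneg _

lemma decompositionAverages_nonneg {ι : Type} [Fintype ι] {f : (ι → ℂ) → ℝ}
    (hf : ∀ ψ, 0 ≤ f ψ) {ρ : Op ι} {x : ℝ} (hx : x ∈ decompositionAverages f ρ) : 0 ≤ x := by
  obtain ⟨m, p, φ, h, rfl⟩ := hx
  exact Finset.sum_nonneg fun i _ => mul_nonneg (h.nonneg i) (hf _)

lemma bddAbove_decompositionAverages_gPure (hd : 0 < d) (σ : Op (AB d)) :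
    BddAbove (decompositionAverages gPure σ) := by
  refine ⟨1, ?_⟩
  rintro x ⟨m, p, φ, h, rfl⟩
  rw [← h.sum_eq_one]
  refine Finset.sum_le_sum fun i _ => mul_le_of_le_one_right (h.nonneg i) ?_
  refine (gPure_le hd _).trans_eq ?_
  rw [trace_proj, h.pure i, Complex.one_re]

lemma decompositionAverages_nonempty {ι : Type} [Fintype ι] (f : (ι → ℂ) → ℝ) {ρ : Op ι}
    (hρ : IsDensity ρ) : (decompositionAverages f ρ).Nonempty := by
  obtain ⟨v, hv⟩ := exists_sum_proj hρ.1
  obtain ⟨m, p, φ, -, h, -⟩ := exists_isDecomposition hρ.2 v hv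
  exact ⟨_, m, p, φ, h, rfl⟩

/-- The unnormalized form of `G σ ≤ x`. -/
lemma trace_mul_gConcurrence_le {σ : Op (AB d)} {x : ℝ} (hx : x ∈ unnormalizedValues σ) :
    σ.trace.re * gConcurrence (((σ.trace.re : ℝ)⁻¹ : ℂ) • σ) ≤ x := by
  obtain ⟨h0, him⟩ := Complex.nonneg_iff.1 (trace_nonneg_of_mem_unnormalizedValues hx)
  have htr : σ.trace = (σ.trace.re : ℂ) := Complex.ext rfl him.symm
  -- At trace zero the normalized state is a default value, but its weight is zero.
  rcases h0.eq_or_lt with h | hpos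
  · rw [← h, zero_mul]
    exact unnormalizedValues_nonneg hx
  have hc : (σ.trace.re : ℂ) ≠ 0 := by exact_mod_cast hpos.ne'
  have hmem : σ.trace.re⁻¹ * x ∈ decompositionAverages gPure (((σ.trace.re : ℝ)⁻¹ : ℂ) • σ) := by
    refine mem_decompositionAverages_gPure ?_ ?_
    · rw [trace_smul, smul_eq_mul, htr, Complex.ofReal_re, inv_mul_cancel₀ hc]
    · rw [← Complex.ofReal_inv]
      exact smul_mem_unnormalizedValues hx (inv_nonneg.2 h0)
  calc _ ≤ σ.trace.re * (σ.trace.re⁻¹ * x) := by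
        refine mul_le_mul_of_nonneg_left (csInf_le ⟨0, fun y hy => ?_⟩ hmem) h0
        exact decompositionAverages_nonneg gPure_nonneg hy
    _ = x := by rw [← mul_assoc, mul_inv_cancel₀ hpos.ne', one_mul]

end

/-! ### LOCC protocols -/

lemma sum_mul_sum_smul_mul {κ ι α β : Type*} [Fintype κ] [Fintype ι] [Fintype α]
    (M : κ → Matrix β α ℂ) (c : ι → ℂ) (ρ : ι → Matrix α α ℂ) :
    ∑ j, M j * (∑ i, c i • ρ i) * (M j)ᴴ = ∑ i, c i • ∑ j, M j * ρ i * (M j)ᴴ := by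
  simp only [Matrix.mul_sum, Matrix.sum_mul, Finset.smul_sum, Matrix.mul_smul, Matrix.smul_mul]
  exact Finset.sum_comm

lemma traceS_sum_smul {a b s : ℕ} {ι : Type*} [Fintype ι] (c : ι → ℂ) (ρ : ι → Op (ABS a b s)) :
    traceS (∑ i, c i • ρ i) = ∑ i, c i • traceS (ρ i) := by
  ext x y
  simp only [traceS, of_apply, Matrix.sum_apply, Matrix.smul_apply, smul_eq_mul, Finset.mul_sum]
  exact Finset.sum_comm

lemma LOCC.output_sum_smul {d m a b s : ℕ} (P : LOCC d m a b s) {ι : Type*} [Fintype ι]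
    (c : ι → ℂ) (ρ : ι → Op (ABS a b s)) (l : Fin m) :
    P.output (∑ i, c i • ρ i) l = ∑ i, c i • P.output (ρ i) l := by
  induction P with
  | done label =>
    simp only [LOCC.output]
    split_ifs
    · exact traceS_sum_smul c ρ
    · simp
  | alice I next ih =>
    simp only [LOCC.output, Finset.smul_sum]
    rw [Finset.sum_comm]
    refine Finset.sum_congr rfl fun k _ => ?_
    rw [← ih, Instrument.onA, sum_mul_sum_smul_mul]
    rfl
  | bob I next ih =>
    simp only [LOCC.output, Finset.smul_sum]
    rw [Finset.sum_comm]
    refine Finset.sum_congr rfl fun k _ => ?_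
    rw [← ih, Instrument.onB, sum_mul_sum_smul_mul]
    rfl
  | sapna I next ih =>
    simp only [LOCC.output, Finset.smul_sum]
    rw [Finset.sum_comm]
    refine Finset.sum_congr rfl fun k _ => ?_
    rw [← ih, Instrument.onS, sum_mul_sum_smul_mul]
    rfl

lemma LOCC.output_sum {d m a b s : ℕ} (P : LOCC d m a b s) {ι : Type*} [Fintype ι]
    (ρ : ι → Op (ABS a b s)) (l : Fin m) :
    P.output (∑ i, ρ i) l = ∑ i, P.output (ρ i) l := by
  simpa using P.output_sum_smul (fun _ => 1) ρ l

/-- The vector of Alice and Bob that Sapna's basis state `t` is paired with in `Φ`. -/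
def sliceS {a b s : ℕ} (Φ : ABS a b s → ℂ) (t : Fin s) : Fin a × Fin b → ℂ :=
  fun x => Φ (x.1, x.2, t)

lemma traceS_proj {a b s : ℕ} (Φ : ABS a b s → ℂ) :
    traceS (proj Φ) = ∑ t, proj (sliceS Φ t) := by
  ext x y
  simp [traceS, proj, vecMulVec_apply, Matrix.sum_apply, sliceS]

lemma sum_gPure_sliceS_mem {d s : ℕ} (Φ : ABS d d s → ℂ) :
    ∑ t, gPure (sliceS Φ t) ∈ unnormalizedValues (traceS (proj Φ)) :=
  ⟨Fin s, inferInstance, sliceS Φ, (traceS_proj Φ).symm, rfl⟩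

/-- `X ⊗ Y ⊗ 1` applied to a vector. -/
def applyAB {d a b s : ℕ} (X : Matrix (Fin a) (Fin d) ℂ) (Y : Matrix (Fin b) (Fin d) ℂ)
    (Φ : ABS d d s → ℂ) : ABS a b s → ℂ :=
  (X ⊗ₖ (Y ⊗ₖ (1 : Op (Fin s)))) *ᵥ Φ

lemma applyAB_one {d s : ℕ} (Φ : ABS d d s → ℂ) : applyAB 1 1 Φ = Φ := by
  rw [applyAB, one_kronecker_one, one_kronecker_one, one_mulVec]

lemma coeffMatrix_sliceS_applyAB {d s : ℕ} (X Y : Matrix (Fin d) (Fin d) ℂ) (Φ : ABS d d s → ℂ)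
    (t : Fin s) : coeffMatrix (sliceS (applyAB X Y Φ) t) = X * coeffMatrix (sliceS Φ t) * Yᵀ := by
  ext i j
  simp only [coeffMatrix, sliceS, applyAB, of_apply, mulVec, dotProduct, kroneckerMap_apply,
    Fintype.sum_prod_type, mul_apply, one_apply, transpose_apply, mul_ite, mul_one, mul_zero,
    ite_mul, zero_mul, Finset.sum_ite_eq, Finset.mem_univ, if_true, Finset.sum_mul]
  rw [Finset.sum_comm]
  exact Finset.sum_congr rfl fun _ _ => Finset.sum_congr rfl fun _ _ => by ring

/-- The factor does not depend on `t`, so it comes out of the sum over Sapna's basis. -/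
lemma gPure_sliceS_applyAB {d s : ℕ} (X Y : Matrix (Fin d) (Fin d) ℂ) (Φ : ABS d d s → ℂ)
    (t : Fin s) :
    gPure (sliceS (applyAB X Y Φ) t) = detRoot X * detRoot Y * gPure (sliceS Φ t) := by
  rw [gPure_eq, gPure_eq, coeffMatrix_sliceS_applyAB, detRoot_mul, detRoot_mul, detRoot_transpose]
  ring

lemma onA_proj_applyAB {d a b s : ℕ} (I : Instrument a) (k : Fin I.outcomes)
    (X : Matrix (Fin a) (Fin d) ℂ) (Y : Matrix (Fin b) (Fin d) ℂ) (Φ : ABS d d s → ℂ) :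
    I.onA k (proj (applyAB X Y Φ)) = ∑ j, proj (applyAB (I.kraus k j * X) Y Φ) := by
  refine Finset.sum_congr rfl fun j _ => ?_
  rw [mul_proj_mul, applyAB, mulVec_mulVec, ← mul_kronecker_mul, Matrix.one_mul, applyAB]

lemma onB_proj_applyAB {d a b s : ℕ} (I : Instrument b) (k : Fin I.outcomes)
    (X : Matrix (Fin a) (Fin d) ℂ) (Y : Matrix (Fin b) (Fin d) ℂ) (Φ : ABS d d s → ℂ) :
    I.onB k (proj (applyAB X Y Φ)) = ∑ j, proj (applyAB X (I.kraus k j * Y) Φ) := by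
  refine Finset.sum_congr rfl fun j _ => ?_
  rw [mul_proj_mul, applyAB, mulVec_mulVec, ← mul_kronecker_mul, ← mul_kronecker_mul,
    Matrix.one_mul, Matrix.one_mul, applyAB]

/-- `1 ⊗ 1 ⊗ K` applied to a vector. -/
def applyS {a b s s' : ℕ} (K : Matrix (Fin s') (Fin s) ℂ) (Φ : ABS a b s → ℂ) : ABS a b s' → ℂ :=
  ((1 : Op (Fin a)) ⊗ₖ ((1 : Op (Fin b)) ⊗ₖ K)) *ᵥ Φ

/-- Sapna's operators commute with `X ⊗ Y ⊗ 1`, so they can be moved into `Φ`. -/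
lemma onS_proj_applyAB {d a b s : ℕ} (I : Instrument s) (k : Fin I.outcomes)
    (X : Matrix (Fin a) (Fin d) ℂ) (Y : Matrix (Fin b) (Fin d) ℂ) (Φ : ABS d d s → ℂ) :
    I.onS k (proj (applyAB X Y Φ)) = ∑ j, proj (applyAB X Y (applyS (I.kraus k j) Φ)) := by
  refine Finset.sum_congr rfl fun j _ => ?_
  rw [mul_proj_mul, applyAB, applyAB, applyS, mulVec_mulVec, mulVec_mulVec, ← mul_kronecker_mul,
    ← mul_kronecker_mul, ← mul_kronecker_mul, ← mul_kronecker_mul]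
  simp only [Matrix.one_mul, Matrix.mul_one]

lemma sliceS_applyS {a b s s' : ℕ} (K : Matrix (Fin s') (Fin s) ℂ) (Φ : ABS a b s → ℂ)
    (t : Fin s') (x : Fin a × Fin b) :
    sliceS (applyS K Φ) t x = ∑ u, K t u * Φ (x.1, x.2, u) := by
  simp [sliceS, applyS, mulVec, dotProduct, Fintype.sum_prod_type, one_apply, ite_mul]

/-- An instrument of Sapna does not change the average state of Alice and Bob. -/
lemma sum_traceS_proj_applyS {a b s : ℕ} {κ : Type*} [Fintype κ] {c : κ → ℕ}
    (K : (k : κ) → Matrix (Fin (c k)) (Fin s) ℂ) (hK : ∑ k, (K k)ᴴ * K k = 1)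
    (Φ : ABS a b s → ℂ) : ∑ k, traceS (proj (applyS (K k) Φ)) = traceS (proj Φ) := by
  ext x y
  -- Tracing out Sapna's new index leaves only the Gram matrix of `K k`.
  have h : ∀ k, traceS (proj (applyS (K k) Φ)) x y =
      ∑ u, ∑ w, ((K k)ᴴ * K k) w u * (Φ (x.1, x.2, u) * star (Φ (y.1, y.2, w))) := fun k => by
    rw [traceS_proj]
    simp only [Matrix.sum_apply, proj, vecMulVec_apply, Pi.star_apply, sliceS_applyS, star_sum,
      Finset.sum_mul_sum]
    rw [Finset.sum_comm]
    refine Finset.sum_congr rfl fun u _ => ?_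
    rw [Finset.sum_comm]
    refine Finset.sum_congr rfl fun w _ => ?_
    rw [mul_apply, Finset.sum_mul]
    refine Finset.sum_congr rfl fun t _ => ?_
    rw [star_mul', conjTranspose_apply]
    ring
  rw [Matrix.sum_apply]
  simp only [h]
  rw [Finset.sum_comm]
  simp only [Finset.sum_comm (s := (Finset.univ : Finset κ)), ← Finset.sum_mul,
    ← Matrix.sum_apply, hK, traceS_proj]
  simp [Matrix.sum_apply, proj, vecMulVec_apply, sliceS, one_apply, ite_mul]

/-- Each Kraus operator is treated as a branch of its own. Forgetting its index only mixes states,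
and the branch vectors still decompose the mixture. -/
lemma Instrument.sum_kraus {a : ℕ} (I : Instrument a) :
    ∑ i : (Σ k, Fin (I.numKraus k)), (I.kraus i.1 i.2)ᴴ * I.kraus i.1 i.2 = 1 := by
  rw [Fintype.sum_sigma]
  exact I.complete

lemma Instrument.sum_detRoot_le {d a : ℕ} (hd : 0 < d) (I : Instrument a)
    (X : Matrix (Fin a) (Fin d) ℂ) :
    ∑ i : (Σ k, Fin (I.numKraus k)), detRoot (I.kraus i.1 i.2 * X) ≤ detRoot X := by
  refine GConcurrence.sum_detRoot_le hd _ X ?_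
  have : ∀ i : (Σ k, Fin (I.numKraus k)), (I.kraus i.1 i.2 * X)ᴴ * (I.kraus i.1 i.2 * X) =
      Xᴴ * ((I.kraus i.1 i.2)ᴴ * I.kraus i.1 i.2) * X := fun i => by
    simp only [conjTranspose_mul, Matrix.mul_assoc]
  simp only [this]
  rw [← Matrix.sum_mul, ← Matrix.mul_sum, I.sum_kraus, Matrix.mul_one]

/-- Takes the largest of the finitely many `y k`; `hσ` supplies a value when `κ` is empty. -/
lemma exists_mem_unnormalizedValues_sum_mul_le {d : ℕ} {σ : Op (AB d)} {κ : Type} [Fintype κ]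
    (hσ : (unnormalizedValues σ).Nonempty) (y w : κ → ℝ) (hy : ∀ k, y k ∈ unnormalizedValues σ)
    (hw : ∀ k, 0 ≤ w k) {W : ℝ} (hW : ∑ k, w k ≤ W) :
    ∃ z ∈ unnormalizedValues σ, ∑ k, w k * y k ≤ W * z := by
  have := hσ.to_subtype
  obtain ⟨⟨z, hz⟩, hle⟩ :=
    Finite.exists_le (fun k => (⟨y k, hy k⟩ : unnormalizedValues σ))
  refine ⟨z, hz, (Finset.sum_le_sum fun k _ =>
    mul_le_mul_of_nonneg_left (show y k ≤ z from hle k) (hw k)).trans ?_⟩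
  rw [← Finset.sum_mul]
  exact mul_le_mul_of_nonneg_right hW (unnormalizedValues_nonneg hz)

/-- Running a protocol on the vector `(X ⊗ Y ⊗ 1) Φ` produces unnormalized output states whose
total G-concurrence is at most `det (Xᴴ X) ^ (1/d) * det (Yᴴ Y) ^ (1/d)` times the value of some
decomposition of the state of Alice and Bob in `Φ`. -/
theorem LOCC.exists_values_output {d m a b s : ℕ} (hd : 0 < d) (P : LOCC d m a b s)
    (X : Matrix (Fin a) (Fin d) ℂ) (Y : Matrix (Fin b) (Fin d) ℂ) (Φ : ABS d d s → ℂ) :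
    ∃ x : Fin m → ℝ, (∀ l, x l ∈ unnormalizedValues (P.output (proj (applyAB X Y Φ)) l)) ∧
      ∃ y ∈ unnormalizedValues (traceS (proj Φ)), ∑ l, x l ≤ detRoot X * detRoot Y * y := by
  induction P with
  | done label =>
    refine ⟨fun l => if l = label then ∑ t, gPure (sliceS (applyAB X Y Φ) t) else 0, fun l => ?_,
      _, sum_gPure_sliceS_mem Φ, ?_⟩
    · simp only [LOCC.output]
      split_ifs
      · exact sum_gPure_sliceS_mem _
      · exact zero_mem_unnormalizedValues
    · simp [gPure_sliceS_applyAB, Finset.mul_sum]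
  | alice I next ih =>
    choose x hx y hy hxy using fun i : (Σ k, Fin (I.numKraus k)) =>
      ih i.1 (I.kraus i.1 i.2 * X) Y Φ
    obtain ⟨z, hz, hle⟩ := exists_mem_unnormalizedValues_sum_mul_le ⟨_, sum_gPure_sliceS_mem Φ⟩
      y (fun i => detRoot (I.kraus i.1 i.2 * X) * detRoot Y) hy
      (fun i => mul_nonneg (detRoot_nonneg _) (detRoot_nonneg _)) (W := detRoot X * detRoot Y)
      (by rw [← Finset.sum_mul]
          exact mul_le_mul_of_nonneg_right (I.sum_detRoot_le hd X) (detRoot_nonneg _))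
    refine ⟨fun l => ∑ i, x i l, fun l => ?_, z, hz, ?_⟩
    · have := sum_mem_unnormalizedValues fun i => hx i l
      rw [Fintype.sum_sigma (fun i => LOCC.output _ _ _)] at this
      simpa only [LOCC.output, onA_proj_applyAB, LOCC.output_sum] using this
    · rw [Finset.sum_comm]
      exact (Finset.sum_le_sum fun i _ => hxy i).trans hle
  | bob I next ih =>
    choose x hx y hy hxy using fun i : (Σ k, Fin (I.numKraus k)) =>
      ih i.1 X (I.kraus i.1 i.2 * Y) Φ
    obtain ⟨z, hz, hle⟩ := exists_mem_unnormalizedValues_sum_mul_le ⟨_, sum_gPure_sliceS_mem Φ⟩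
      y (fun i => detRoot X * detRoot (I.kraus i.1 i.2 * Y)) hy
      (fun i => mul_nonneg (detRoot_nonneg _) (detRoot_nonneg _)) (W := detRoot X * detRoot Y)
      (by rw [← Finset.mul_sum]
          exact mul_le_mul_of_nonneg_left (I.sum_detRoot_le hd Y) (detRoot_nonneg _))
    refine ⟨fun l => ∑ i, x i l, fun l => ?_, z, hz, ?_⟩
    · have := sum_mem_unnormalizedValues fun i => hx i l
      rw [Fintype.sum_sigma (fun i => LOCC.output _ _ _)] at this
      simpa only [LOCC.output, onB_proj_applyAB, LOCC.output_sum] using this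
    · rw [Finset.sum_comm]
      exact (Finset.sum_le_sum fun i _ => hxy i).trans hle
  | sapna I next ih =>
    choose x hx y hy hxy using fun i : (Σ k, Fin (I.numKraus k)) =>
      ih i.1 X Y (applyS (I.kraus i.1 i.2) Φ)
    -- Here the values add up: the states of Alice and Bob in Sapna's branches sum to the original
    -- one, and `X`, `Y` are unchanged.
    refine ⟨fun l => ∑ i, x i l, fun l => ?_, ∑ i, y i, ?_, ?_⟩
    · have := sum_mem_unnormalizedValues fun i => hx i l
      rw [Fintype.sum_sigma (fun i => LOCC.output _ _ _)] at this
      simpa only [LOCC.output, onS_proj_applyAB, LOCC.output_sum] using this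
    · rw [← sum_traceS_proj_applyS (fun i : (Σ k, Fin (I.numKraus k)) => I.kraus i.1 i.2)
        I.sum_kraus]
      exact sum_mem_unnormalizedValues hy
    · rw [Finset.sum_comm, Finset.mul_sum]
      exact Finset.sum_le_sum fun i _ => hxy i

lemma trace_traceS {a b s : ℕ} (ρ : Op (ABS a b s)) : (traceS ρ).trace = ρ.trace := by
  simp [trace, traceS, Fintype.sum_prod_type]

lemma assistancePure_nonneg {d n : ℕ} (ψ : ABS d d n → ℂ) : 0 ≤ assistancePure ψ :=
  Real.sSup_nonneg fun _ hx => decompositionAverages_nonneg gPure_nonneg hx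

lemma assistance_nonneg {d n : ℕ} (ρ : Op (ABS d d n)) : 0 ≤ assistance ρ :=
  Real.sInf_nonneg fun _ hx => decompositionAverages_nonneg assistancePure_nonneg hx

lemma le_assistancePure {d n : ℕ} (hd : 0 < d) {ψ : ABS d d n → ℂ} (hψ : IsPure ψ) {y : ℝ}
    (hy : y ∈ unnormalizedValues (traceS (proj ψ))) : y ≤ assistancePure ψ :=
  le_csSup (bddAbove_decompositionAverages_gPure hd _)
    (mem_decompositionAverages_gPure (by rw [trace_traceS, trace_proj, hψ]) hy)

/-- The average G-concurrence that a protocol produces is at most the average G-concurrence of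
assistance of every pure-state decomposition of the initial state. -/
lemma LOCC.sum_gConcurrence_le {d m n : ℕ} (hd : 0 < d) {ρ : Op (ABS d d n)} (P : LOCC d m d d n)
    {N : ℕ} {q : Fin N → ℝ} {ψ : Fin N → ABS d d n → ℂ} (h : IsDecomposition ρ q ψ) :
    ∑ l, P.prob ρ l * gConcurrence (P.state ρ l) ≤ ∑ j, q j * assistancePure (ψ j) := by
  choose x hx y hy hxy using fun j => P.exists_values_output hd 1 1 (ψ j)
  simp only [applyAB_one, detRoot_one, one_mul] at hx hxy
  have hmem : ∀ l, ∑ j, q j * x j l ∈ unnormalizedValues (P.output ρ l) := fun l => by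
    rw [h.eq_sum, LOCC.output_sum_smul]
    exact sum_mem_unnormalizedValues fun j => smul_mem_unnormalizedValues (hx j l) (h.nonneg j)
  refine (Finset.sum_le_sum fun l _ => trace_mul_gConcurrence_le (hmem l)).trans ?_
  rw [Finset.sum_comm]
  refine Finset.sum_le_sum fun j _ => ?_
  rw [← Finset.mul_sum]
  exact mul_le_mul_of_nonneg_left ((hxy j).trans (le_assistancePure hd (h.pure j) (hy j)))
    (h.nonneg j)

end GConcurrence

theorem theorem2 {d n : ℕ} (ρ : GConcurrence.Op (GConcurrence.ABS d d n))
    (hρ : GConcurrence.IsDensity ρ) :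
    BddAbove (GConcurrence.assistedAverages ρ) ∧
      GConcurrence.assistedG ρ ≤ GConcurrence.assistance ρ := by
  have hd : 0 < d := by
    rcases Nat.eq_zero_or_pos d with rfl | hd
    -- For `d = 0` the space is zero, and no operator on it has trace one.
    · simpa [Matrix.trace] using hρ.2
    · exact hd
  have hle : ∀ x ∈ GConcurrence.assistedAverages ρ, x ≤ GConcurrence.assistance ρ := by
    rintro x ⟨m, P, rfl⟩
    refine le_csInf (GConcurrence.decompositionAverages_nonempty _ hρ) ?_
    rintro y ⟨N, q, ψ, h, rfl⟩
    exact P.sum_gConcurrence_le hd h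
  exact ⟨⟨_, hle⟩, Real.sSup_le hle (GConcurrence.assistance_nonneg ρ)⟩
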